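/- Let $R$ be a commutative ring with unity and let $C$ be a semidualizing $R$-module, that is: $C$ has a resolution by finitely generated projective $R$-modules, the homothety map $R\to\operatorname{Hom}_R(C,C)$ is an isomorphism, and $\operatorname{Ext}^i_R(C,C)=0$ for all $i\ge 1$. An $R$-module $M$ is called $G_C$-projective if there is an exact sequence of $R$-modules $$\mathbb X=\ \cdots\to P_1\to P_0\to C\otimes_R P_{-1}\to C\otimes_R P_{-2}\to\cdots$$ with all $P_i$ projective, such that $M\cong\operatorname{im}(P_0\to C\otimes_R P_{-1})$ and $\operatorname{Hom}_R(\mathbb X,C\otimes_R P)$ is exact for every projective $R$-module $P$. An $R$-module $M$ is called $G_C$-flat if there is an exact sequence of $R$-modules $$\mathbb Y=\ \cdots\to F_1\to F_0\to C\otimes_R F_{-1}\to C\otimes_R F_{-2}\to\cdots$$ with all $F_i$ flat, such that $M\cong\operatorname{im}(F_0\to C\otimes_R F_{-1})$ and $\operatorname{Hom}_R(C,I)\otimes_R\mathbb Y$ is exact for every injective $R$-module $I$. The $G_C$-flat dimension $G_C\text{-}\mathrm{fd}_R(M)$ is the infimum, over all exact sequences $\cdots\to X_1\to X_0\to M\to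 0$ with all $X_n$ $G_C$-flat, of $\sup\{n\ge 0\mid X_n\ne 0\}$, and the $C$-Gorenstein weak global dimension of $R$ is $G_C\text{-}w\mathrm{gldim}(R)=\sup\{G_C\text{-}\mathrm{fd}_R(M)\mid M \text{ an } R\text{-module}\}$. The ring $R$ is called $G_C$-semihereditary if $R$ is coherent and every submodule of a flat $R$-module is $G_C$-flat. **Theorem.** Suppose that $G_C\text{-}w\mathrm{gldim}(R)<\infty$. If every finitely generated submodule of a $G_C$-projective $R$-module is $G_C$-projective, then $R$ is $G_C$-semihereditary. -/

import Mathlib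

open TensorProduct

universe u

namespace GCModules

/-- A sequence of modules and linear maps, infinite in both directions,
`⋯ → left 1 → left 0 → right 0 → right 1 → ⋯`. -/
structure TwoSidedSeq (R : Type u) [CommRing R] where
  left : ℕ → ModuleCat.{u} R
  right : ℕ → ModuleCat.{u} R
  dLeft (n : ℕ) : left (n + 1) →ₗ[R] left n
  mid : left 0 →ₗ[R] right 0
  dRight (n : ℕ) : right n →ₗ[R] right (n + 1)

namespace TwoSidedSeq

variable {R : Type u} [CommRing R]

/-- The sequence is exact at every term. -/
structure IsExact (X : TwoSidedSeq R) : Prop where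
  left (n : ℕ) : Function.Exact (X.dLeft (n + 1)) (X.dLeft n)
  left_mid : Function.Exact (X.dLeft 0) X.mid
  mid_right : Function.Exact X.mid (X.dRight 0)
  right (n : ℕ) : Function.Exact (X.dRight n) (X.dRight (n + 1))

/-- The sequence `Hom_R(X, W)`, with maps given by precomposition, is exact at every term. -/
structure IsHomExact (X : TwoSidedSeq R) (W : Type u) [AddCommGroup W] [Module R W] : Prop where
  left (n : ℕ) : Function.Exact ((X.dLeft n).lcomp R W) ((X.dLeft (n + 1)).lcomp R W)
  left_mid : Function.Exact (X.mid.lcomp R W) ((X.dLeft 0).lcomp R W)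
  mid_right : Function.Exact ((X.dRight 0).lcomp R W) (X.mid.lcomp R W)
  right (n : ℕ) : Function.Exact ((X.dRight (n + 1)).lcomp R W) ((X.dRight n).lcomp R W)

/-- The sequence `J ⊗_R X` is exact at every term. -/
structure IsTensorExact (X : TwoSidedSeq R) (J : Type u) [AddCommGroup J] [Module R J] :
    Prop where
  left (n : ℕ) : Function.Exact ((X.dLeft (n + 1)).lTensor J) ((X.dLeft n).lTensor J)
  left_mid : Function.Exact ((X.dLeft 0).lTensor J) (X.mid.lTensor J)
  mid_right : Function.Exact (X.mid.lTensor J) ((X.dRight 0).lTensor J)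
  right (n : ℕ) : Function.Exact ((X.dRight n).lTensor J) ((X.dRight (n + 1)).lTensor J)

end TwoSidedSeq

/-- An exact sequence `⋯ → obj 1 → obj 0 → M → 0`. -/
structure LeftResolution (R : Type u) [CommRing R] (M : Type u) [AddCommGroup M]
    [Module R M] where
  obj : ℕ → ModuleCat.{u} R
  d (n : ℕ) : obj (n + 1) →ₗ[R] obj n
  ε : obj 0 →ₗ[R] M
  exact_d (n : ℕ) : Function.Exact (d (n + 1)) (d n)
  exact_ε : Function.Exact (d 0) ε
  surjective_ε : Function.Surjective ε

/-- The length `sup {n ≥ 0 | obj n ≠ 0}` of a resolution. -/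
noncomputable def LeftResolution.length {R : Type u} [CommRing R] {M : Type u} [AddCommGroup M]
    [Module R M] (X : LeftResolution R M) : ℕ∞ :=
  ⨆ (n : ℕ) (_ : Nontrivial (X.obj n)), (n : ℕ∞)

/-- For a class `𝒳` of modules, the `𝒳`-projective dimension of `M`: the infimum of the lengths
of the resolutions of `M` by modules of `𝒳` (it is `⊤` if there is none of finite length). -/
noncomputable def relProjDim {R : Type u} [CommRing R] (𝒳 : ModuleCat.{u} R → Prop)
    (M : Type u) [AddCommGroup M] [Module R M] : ℕ∞ :=
  ⨅ (X : LeftResolution R M) (_ : ∀ n, 𝒳 (X.obj n)), X.length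

/-- Semidualizing modules. -/
structure IsSemidualizing (R : Type u) [CommRing R] (C : Type u) [AddCommGroup C]
    [Module R C] : Prop where
  /-- `C` has a resolution by finitely generated projective modules. -/
  exists_resolution : ∃ X : LeftResolution R C,
    ∀ n, Module.Finite R (X.obj n) ∧ Module.Projective R (X.obj n)
  /-- The homothety map `R → Hom_R(C, C)` is an isomorphism. -/
  bijective_homothety : Function.Bijective (LinearMap.lsmul R C)
  /-- `Ext^i_R(C, C) = 0` for `i ≥ 1`. -/
  ext_eq_zero (i : ℕ) (hi : 1 ≤ i) :
    Subsingleton (CategoryTheory.Abelian.Ext (ModuleCat.of R C) (ModuleCat.of R C) i)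

section

variable (R : Type u) [CommRing R] (C : Type u) [AddCommGroup C] [Module R C]

/-- `G_C`-projective modules. -/
def IsGCProjective (M : Type u) [AddCommGroup M] [Module R M] : Prop :=
  ∃ X : TwoSidedSeq R,
    (∀ n, Module.Projective R (X.left n)) ∧
    (∀ n, ∃ P : ModuleCat.{u} R, Module.Projective R P ∧
      Nonempty (X.right n ≃ₗ[R] C ⊗[R] P)) ∧
    X.IsExact ∧
    Nonempty (M ≃ₗ[R] LinearMap.range X.mid) ∧
    ∀ P : ModuleCat.{u} R, Module.Projective R P → X.IsHomExact (C ⊗[R] P)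

/-- `G_C`-flat modules. -/
def IsGCFlat (M : Type u) [AddCommGroup M] [Module R M] : Prop :=
  ∃ X : TwoSidedSeq R,
    (∀ n, Module.Flat R (X.left n)) ∧
    (∀ n, ∃ F : ModuleCat.{u} R, Module.Flat R F ∧
      Nonempty (X.right n ≃ₗ[R] C ⊗[R] F)) ∧
    X.IsExact ∧
    Nonempty (M ≃ₗ[R] LinearMap.range X.mid) ∧
    ∀ I : ModuleCat.{u} R, Module.Injective R I → X.IsTensorExact (C →ₗ[R] I)

/-- The `G_C`-flat dimension of a module. -/
noncomputable def gcFlatDim (M : Type u) [AddCommGroup M] [Module R M] : ℕ∞ :=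
  relProjDim (fun N : ModuleCat.{u} R => IsGCFlat R C N) M

/-- The `C`-Gorenstein weak global dimension of `R`. -/
noncomputable def gcWeakGlobalDim : ℕ∞ :=
  ⨆ M : ModuleCat.{u} R, gcFlatDim R C M

/-- A commutative ring is coherent if its finitely generated ideals are finitely presented. -/
def IsCoherent : Prop :=
  ∀ I : Ideal R, I.FG → Module.FinitePresentation R I

/-- `R` is `C`-Gorenstein semihereditary. -/
def IsGCSemihereditary : Prop :=
  IsCoherent R ∧
    ∀ F : ModuleCat.{u} R, Module.Flat R F → ∀ N : Submodule R F, IsGCFlat R C N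

end

end GCModules

/-!
Finitely generated submodules of `Cˢ`, among them the finitely generated ideals, are
`G_C`-projective by hypothesis, hence `C`-reflexive and finitely presented. Dualizing a short exact
sequence `0 → M* → Cˢ → L → 0` presents `M` by `C`-duals and gives `Tor₁(J, M) = 0` for
`J = Hom(C, E)` with `E` injective and `M` a finitely generated ideal or `C` itself. Hence `J` has
flat dimension at most one, and evaluation `C ⊗ J → E` is an isomorphism.

Let `N ⊆ C ⊗ F` with `F` flat, and embed `(C ⊗ F) / N` in an injective module `E`. The composite
`C ⊗ F → E` corresponds to a map `F → J`. Adding a free cover `G₀ → J` gives a surjection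
`F × G₀ → J` with flat kernel `G`, and `0 → C ⊗ G → C ⊗ (F × G₀) → C ⊗ J ≅ E → 0` is exact. So
`N`, the kernel of `C ⊗ F → E`, is also the kernel of `C ⊗ G → C ⊗ G₀`, and the image of the latter
map is again a submodule of some `C ⊗ G₀` with `G₀` flat. Iterating, `N` has a coresolution by
modules `C ⊗ G`; the vanishing of `Tor₁(J, -)` on submodules of flat modules and of modules
`C ⊗ F` makes it a `G_C`-flat one. Finally, `R` embeds in a power `Cᵗ`, so every flat module embeds
in some `C ⊗ F`.
-/

namespace GCModules

/-- Short exact sequences `0 → A → B → D → 0` of modules, as a property of the two maps. -/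
structure ShortExact {R A B D : Type*} [Ring R] [AddCommGroup A] [Module R A] [AddCommGroup B]
    [Module R B] [AddCommGroup D] [Module R D] (f : A →ₗ[R] B) (g : B →ₗ[R] D) : Prop where
  injective : Function.Injective f
  exact : Function.Exact f g
  surjective : Function.Surjective g

section ShortExact

variable {R A B D : Type*} [Ring R] [AddCommGroup A] [Module R A] [AddCommGroup B] [Module R B]
  [AddCommGroup D] [Module R D]

theorem ShortExact.ker_subtype {g : B →ₗ[R] D} (hg : Function.Surjective g) :
    ShortExact (LinearMap.ker g).subtype g :=
  ⟨Subtype.val_injective, LinearMap.exact_subtype_ker_map g, hg⟩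

theorem exact_rangeRestrict {f : A →ₗ[R] B} {g : B →ₗ[R] D} (h : Function.Exact f g) :
    Function.Exact f g.rangeRestrict :=
  LinearMap.exact_iff.mpr (g.ker_rangeRestrict.trans h.linearMap_ker_eq)

theorem ShortExact.rangeRestrict {f : A →ₗ[R] B} {g : B →ₗ[R] D} (hf : Function.Injective f)
    (h : Function.Exact f g) : ShortExact f g.rangeRestrict :=
  ⟨hf, exact_rangeRestrict h, g.surjective_rangeRestrict⟩

theorem ShortExact.subtype_range {f : A →ₗ[R] B} {g : B →ₗ[R] D} (h : Function.Exact f g)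
    (hg : Function.Surjective g) : ShortExact (LinearMap.range f).subtype g :=
  ⟨Subtype.val_injective, fun y => (h y).trans (by simp), hg⟩

end ShortExact

section Ext

open CategoryTheory Abelian

variable {R : Type u} [CommRing R] {K F M : Type u} [AddCommGroup K] [Module R K]
  [AddCommGroup F] [Module R F] [AddCommGroup M] [Module R M] {f : K →ₗ[R] F} {g : F →ₗ[R] M}

theorem ShortExact.shortComplex_shortExact (h : ShortExact f g) :
    (ShortComplex.moduleCatMk f g h.exact.linearMap_comp_eq_zero).ShortExact :=
  ModuleCat.shortComplex_shortExact _ h.exact h.injective h.surjective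

variable {N : Type u} [AddCommGroup N] [Module R N]

theorem ShortExact.subsingleton_ext_of_projective [Module.Projective R F] (h : ShortExact f g)
    {i : ℕ} (hM : Subsingleton (Ext (ModuleCat.of R M) (ModuleCat.of R N) (i + 2))) :
    Subsingleton (Ext (ModuleCat.of R K) (ModuleCat.of R N) (i + 1)) := by
  have : Projective (ShortComplex.moduleCatMk f g h.exact.linearMap_comp_eq_zero).X₂ :=
    (IsProjective.iff_projective F).mp inferInstance
  refine subsingleton_of_forall_eq 0 fun x => ?_
  obtain ⟨y, rfl⟩ := Ext.contravariant_sequence_exact₁ h.shortComplex_shortExact _ x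
    (show 1 + (i + 1) = i + 2 by lia) (hM.elim _ _)
  rw [Ext.eq_zero_of_projective y]
  exact Ext.comp_zero ..

theorem ShortExact.exists_extend_of_subsingleton_ext (h : ShortExact f g)
    (hM : Subsingleton (Ext (ModuleCat.of R M) (ModuleCat.of R N) 1)) (φ : K →ₗ[R] N) :
    ∃ ψ : F →ₗ[R] N, ψ ∘ₗ f = φ := by
  obtain ⟨y, hy⟩ := Ext.contravariant_sequence_exact₁ h.shortComplex_shortExact (ModuleCat.of R N)
    (Ext.mk₀ (ModuleCat.ofHom φ)) (add_zero 1) (hM.elim _ _)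
  obtain ⟨ψ, rfl⟩ := Ext.addEquiv₀.symm.surjective y
  have hψ : Ext.mk₀ (ModuleCat.ofHom f ≫ ψ) = Ext.mk₀ (ModuleCat.ofHom φ) :=
    (Ext.mk₀_comp_mk₀ _ _).symm.trans hy
  exact ⟨ψ.hom, congrArg ModuleCat.Hom.hom ((Ext.mk₀_bijective _ _).injective hψ)⟩

theorem LeftResolution.exists_extend_of_subsingleton_ext (X : LeftResolution R M)
    (hX : ∀ n, Module.Projective R (X.obj n))
    (hM : ∀ i, 1 ≤ i → Subsingleton (Ext (ModuleCat.of R M) (ModuleCat.of R N) i))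
    (n : ℕ) (φ : LinearMap.range (X.d n) →ₗ[R] N) :
    ∃ ψ : X.obj n →ₗ[R] N, ψ ∘ₗ (LinearMap.range (X.d n)).subtype = φ := by
  have hzero := ShortExact.subtype_range X.exact_ε X.surjective_ε
  have hsucc (n : ℕ) : ShortExact (LinearMap.range (X.d (n + 1))).subtype (X.d n).rangeRestrict :=
    .rangeRestrict Subtype.val_injective fun y => (X.exact_d n y).trans (by simp)
  have hext (n : ℕ) : ∀ i, Subsingleton
      (Ext (ModuleCat.of R (LinearMap.range (X.d n))) (ModuleCat.of R N) (i + 1)) := by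
    induction n with
    | zero => exact fun i => hzero.subsingleton_ext_of_projective (hM (i + 2) (by lia))
    | succ n ih => exact fun i => (hsucc n).subsingleton_ext_of_projective (ih (i + 1))
  cases n with
  | zero => exact hzero.exists_extend_of_subsingleton_ext (hM 1 le_rfl) φ
  | succ n => exact (hsucc n).exists_extend_of_subsingleton_ext (hext n 0) φ

end Ext

section HomExactness

variable {R A B D W : Type*} [CommRing R] [AddCommGroup A] [Module R A] [AddCommGroup B]
  [Module R B] [AddCommGroup D] [Module R D] [AddCommGroup W] [Module R W]
  {f : A →ₗ[R] B} {g : B →ₗ[R] D}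

theorem exact_lcomp_iff_exists_extend (h : Function.Exact f g) :
    Function.Exact (g.lcomp R W) (f.lcomp R W) ↔ ∀ φ : LinearMap.range g →ₗ[R] W,
      ∃ ψ : D →ₗ[R] W, ψ ∘ₗ (LinearMap.range g).subtype = φ := by
  have hrange : Function.Exact (g.rangeRestrict.lcomp R W) (f.lcomp R W) :=
    LinearMap.exact_lcomp_of_exact_of_surjective W (exact_rangeRestrict h)
      g.surjective_rangeRestrict
  constructor
  · intro hW φ
    obtain ⟨ψ, hψ⟩ := (hW (φ ∘ₗ g.rangeRestrict)).mp (hrange.apply_apply_eq_zero φ)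
    exact ⟨ψ, (LinearMap.cancel_right g.surjective_rangeRestrict).mp hψ⟩
  · intro hext φ
    rw [hrange φ]
    constructor
    · rintro ⟨φ', rfl⟩
      obtain ⟨ψ, rfl⟩ := hext φ'
      exact ⟨ψ, rfl⟩
    · rintro ⟨ψ, rfl⟩
      exact ⟨ψ ∘ₗ (LinearMap.range g).subtype, rfl⟩

variable {P : Type*} [AddCommGroup P] [Module R P] [Module.Projective R P]

theorem exists_lift_of_exact (h : Function.Exact f g) (v : P →ₗ[R] B) (hv : g ∘ₗ v = 0) :
    ∃ w : P →ₗ[R] A, f ∘ₗ w = v := by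
  have hmem (p : P) : v p ∈ LinearMap.range f := (h _).mp (LinearMap.congr_fun hv p)
  obtain ⟨w, hw⟩ := Module.projective_lifting_property f.rangeRestrict (v.codRestrict _ hmem)
    f.surjective_rangeRestrict
  exact ⟨w, LinearMap.ext fun p => congrArg Subtype.val (LinearMap.congr_fun hw p)⟩

theorem exact_lcomp_rTensor (h : Function.Exact (g.lcomp R W) (f.lcomp R W)) :
    Function.Exact ((g.rTensor P).lcomp R W) ((f.rTensor P).lcomp R W) := by
  intro φ
  constructor
  · intro hφ
    obtain ⟨w, hw⟩ := exists_lift_of_exact h (TensorProduct.curry φ).flip (by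
      ext p a
      exact LinearMap.congr_fun hφ (a ⊗ₜ p))
    refine ⟨TensorProduct.lift w.flip, ?_⟩
    ext b p
    exact LinearMap.congr_fun (LinearMap.congr_fun hw p) b
  · rintro ⟨ψ, rfl⟩
    ext a p
    exact LinearMap.congr_fun
      (h.apply_apply_eq_zero (ψ ∘ₗ (TensorProduct.mk R D P).flip p)) a

end HomExactness

section DirectSumsOfC

variable {R C K F : Type*} [CommRing R] [AddCommGroup C] [Module R C] [AddCommGroup K]
  [Module R K] [AddCommGroup F] [Module R F]

theorem exists_retract_finsupp {A P : Type*} [AddCommGroup A] [Module R A] [AddCommGroup P]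
    [Module R P] [Module.Projective R P] (e : A ≃ₗ[R] C ⊗[R] P) :
    ∃ (i : A →ₗ[R] (P →₀ C)) (r : (P →₀ C) →ₗ[R] A), r ∘ₗ i = LinearMap.id := by
  classical
  obtain ⟨s, hs⟩ := Module.projective_def'.mp (inferInstance : Module.Projective R P)
  have hCs : (Finsupp.linearCombination R id).lTensor C ∘ₗ s.lTensor C = LinearMap.id := by
    rw [← LinearMap.lTensor_comp, hs, LinearMap.lTensor_id]
  let k := TensorProduct.finsuppScalarRight R R C P
  refine ⟨k.toLinearMap ∘ₗ s.lTensor C ∘ₗ e.toLinearMap,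
    e.symm.toLinearMap ∘ₗ (Finsupp.linearCombination R id).lTensor C ∘ₗ k.symm.toLinearMap, ?_⟩
  ext x
  simpa using congrArg e.symm (LinearMap.congr_fun hCs (e x))

theorem exists_factor_finsupp [Module.Finite R K] {S : Type*} (φ : K →ₗ[R] (S →₀ C)) :
    ∃ (s : Finset S) (a : K →ₗ[R] (s → C)) (b : (s → C) →ₗ[R] (S →₀ C)),
      Function.Injective b ∧ b ∘ₗ a = φ := by
  classical
  obtain ⟨t, ht⟩ := (Module.Finite.fg_top : (⊤ : Submodule R K).FG)
  let s : Finset S := t.biUnion fun k => (φ k).support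
  have hrange : LinearMap.range φ ≤ Finsupp.supported C R (s : Set S) := by
    rw [LinearMap.range_eq_map, ← ht, Submodule.map_span_le]
    exact fun k hk => (Finsupp.mem_supported R _).mpr
      (mod_cast Finset.subset_biUnion_of_mem (fun k => (φ k).support) hk)
  let e : Finsupp.supported C R (s : Set S) ≃ₗ[R] (s → C) :=
    (Finsupp.supportedEquivFinsupp (s : Set S)).trans (Finsupp.linearEquivFunOnFinite R C s)
  refine ⟨s, e.toLinearMap ∘ₗ φ.codRestrict _ fun k => hrange ⟨k, rfl⟩,
    (Finsupp.supported C R (s : Set S)).subtype ∘ₗ e.symm.toLinearMap,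
    Subtype.val_injective.comp e.symm.injective, ?_⟩
  ext1 k
  simp

theorem exists_extend_tensor [Module.Finite R K] {f : K →ₗ[R] F}
    (hext : ∀ φ : K →ₗ[R] C, ∃ ψ : F →ₗ[R] C, ψ ∘ₗ f = φ) {P : Type*} [AddCommGroup P]
    [Module R P] [Module.Projective R P] (φ : K →ₗ[R] C ⊗[R] P) :
    ∃ ψ : F →ₗ[R] C ⊗[R] P, ψ ∘ₗ f = φ := by
  obtain ⟨i, r, hr⟩ := exists_retract_finsupp (LinearEquiv.refl R (C ⊗[R] P))
  obtain ⟨s, a, b, -, hab⟩ := exists_factor_finsupp (i ∘ₗ φ)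
  choose ψ hψ using fun j : s => hext (LinearMap.proj j ∘ₗ a)
  have ha : LinearMap.pi ψ ∘ₗ f = a := by
    ext k j
    exact LinearMap.congr_fun (hψ j) k
  refine ⟨r ∘ₗ b ∘ₗ LinearMap.pi ψ, ?_⟩
  rw [LinearMap.comp_assoc, LinearMap.comp_assoc, ha, hab, ← LinearMap.comp_assoc, hr,
    LinearMap.id_comp]

end DirectSumsOfC

section TensorSeq

variable {R : Type u} [CommRing R] {C : Type u} [AddCommGroup C] [Module R C]

/-- The complex `⋯ → X₁ ⊗ P → X₀ ⊗ P → C ⊗ P → 0 → 0 → ⋯` obtained from a resolution `X` of `C`,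
which witnesses that `C ⊗ P` is `G_C`-projective when `P` is projective. -/
noncomputable def LeftResolution.tensorSeq (X : LeftResolution R C) (P : ModuleCat.{u} R) :
    TwoSidedSeq R where
  left n := ModuleCat.of R (X.obj n ⊗[R] P)
  right n := match n with
    | 0 => ModuleCat.of R (C ⊗[R] P)
    | _ + 1 => ModuleCat.of R PUnit
  dLeft n := (X.d n).rTensor P
  mid := X.ε.rTensor P
  dRight _ := 0

theorem LeftResolution.isExact_tensorSeq (X : LeftResolution R C) (P : ModuleCat.{u} R)
    [Module.Flat R P] : (X.tensorSeq P).IsExact where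
  left n := Module.Flat.rTensor_exact P (X.exact_d n)
  left_mid := Module.Flat.rTensor_exact P X.exact_ε
  mid_right := (LinearMap.exact_zero_iff_surjective PUnit.{u + 1} _).mpr
    (LinearMap.rTensor_surjective P X.surjective_ε)
  right _ := (LinearMap.exact_zero_iff_surjective PUnit.{u + 1} _).mpr fun _ => ⟨0, rfl⟩

theorem LeftResolution.isHomExact_tensorSeq (X : LeftResolution R C) (P : ModuleCat.{u} R)
    [Module.Projective R P] {W : Type u} [AddCommGroup W] [Module R W]
    (hext : ∀ n, ∀ φ : LinearMap.range (X.d n) →ₗ[R] W,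
      ∃ ψ : X.obj n →ₗ[R] W, ψ ∘ₗ (LinearMap.range (X.d n)).subtype = φ) :
    (X.tensorSeq P).IsHomExact W where
  left n := exact_lcomp_rTensor ((exact_lcomp_iff_exists_extend (X.exact_d n)).mpr (hext n))
  left_mid := LinearMap.exact_lcomp_of_exact_of_surjective W (X.isExact_tensorSeq P).left_mid
    (LinearMap.rTensor_surjective P X.surjective_ε)
  mid_right := LinearMap.exact_lcomp_of_exact_of_surjective W (X.isExact_tensorSeq P).mid_right
    fun _ => ⟨0, rfl⟩
  right n := LinearMap.exact_lcomp_of_exact_of_surjective W ((X.isExact_tensorSeq P).right n)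
    fun _ => ⟨0, rfl⟩

theorem IsSemidualizing.isGCProjective_tensor (hC : IsSemidualizing R C) (P : ModuleCat.{u} R)
    [Module.Projective R P] : IsGCProjective R C (C ⊗[R] P) := by
  obtain ⟨X, hX⟩ := hC.exists_resolution
  have hfinite n : Module.Finite R (X.obj n) := (hX n).1
  have hproj n : Module.Projective R (X.obj n) := (hX n).2
  refine ⟨X.tensorSeq P, fun n => ?_, fun n => ?_, X.isExact_tensorSeq P, ?_, fun P' _ =>
    X.isHomExact_tensorSeq P fun n => exists_extend_tensor
      (X.exists_extend_of_subsingleton_ext hproj hC.ext_eq_zero n)⟩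
  · exact inferInstanceAs (Module.Projective R (X.obj n ⊗[R] P))
  · cases n with
    | zero => exact ⟨P, inferInstance, ⟨LinearEquiv.refl R _⟩⟩
    | succ n => exact ⟨ModuleCat.of R PUnit, inferInstanceAs (Module.Projective R PUnit.{u + 1}),
        ⟨(0 : PUnit.{u + 1} ≃ₗ[R] C ⊗[R] PUnit.{u + 1})⟩⟩
  · exact ⟨(LinearEquiv.ofTop _ (LinearMap.range_eq_top.mpr
      (LinearMap.rTensor_surjective P X.surjective_ε))).symm⟩

end TensorSeq

section FiniteCopresentation

variable {R : Type u} [CommRing R] {C : Type u} [AddCommGroup C] [Module R C]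

theorem IsGCProjective.of_equiv {M N : Type u} [AddCommGroup M] [Module R M] [AddCommGroup N]
    [Module R N] (e : M ≃ₗ[R] N) (h : IsGCProjective R C M) : IsGCProjective R C N := by
  obtain ⟨X, hleft, hright, hexact, ⟨e'⟩, hhom⟩ := h
  exact ⟨X, hleft, hright, hexact, ⟨e.symm.trans e'⟩, hhom⟩

theorem exact_lcomp_of_equiv {A B D W W' : Type*} [AddCommGroup A] [Module R A] [AddCommGroup B]
    [Module R B] [AddCommGroup D] [Module R D] [AddCommGroup W] [Module R W] [AddCommGroup W']
    [Module R W'] (e : W ≃ₗ[R] W') {f : A →ₗ[R] B} {g : B →ₗ[R] D}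
    (h : Function.Exact (g.lcomp R W) (f.lcomp R W)) :
    Function.Exact (g.lcomp R W') (f.lcomp R W') :=
  (Function.Exact.iff_of_ladder_linearEquiv (e₁ := e.congrRight) (e₂ := e.congrRight)
    (e₃ := e.congrRight) (by ext; rfl) (by ext; rfl)).mpr h

theorem exact_comp_prod_of_retract {M A B F : Type*} [AddCommGroup M] [Module R M]
    [AddCommGroup A] [Module R A] [AddCommGroup B] [Module R B] [AddCommGroup F] [Module R F]
    {f : M →ₗ[R] A} {d : A →ₗ[R] B} (h : Function.Exact f d) {i : A →ₗ[R] F} {r : F →ₗ[R] A}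
    (hri : r ∘ₗ i = LinearMap.id) :
    Function.Exact (i ∘ₗ f) ((d ∘ₗ r).prod (LinearMap.id - i ∘ₗ r)) := by
  have hri' (x : A) : r (i x) = x := LinearMap.congr_fun hri x
  intro x
  simp only [LinearMap.prod_apply, Function.prod_apply, LinearMap.comp_apply, LinearMap.sub_apply,
    LinearMap.id_apply, Prod.mk_eq_zero, sub_eq_zero]
  constructor
  · rintro ⟨hd, hx⟩
    obtain ⟨m, hm⟩ := (h _).mp hd
    exact ⟨m, by rw [hx, ← hm, LinearMap.comp_apply]⟩
  · rintro ⟨m, rfl⟩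
    simp [hri', h.apply_apply_eq_zero]

variable {M : Type u} [AddCommGroup M] [Module R M]

theorem IsGCProjective.exists_finsupp_copresentation (h : IsGCProjective R C M) :
    ∃ (S T : Type u) (j : M →ₗ[R] (S →₀ C)) (d : (S →₀ C) →ₗ[R] (T →₀ C)),
      Function.Injective j ∧ Function.Exact j d ∧
      ∀ φ : M →ₗ[R] C, ∃ ψ : (S →₀ C) →ₗ[R] C, ψ ∘ₗ j = φ := by
  obtain ⟨X, -, hright, hexact, ⟨e⟩, hhom⟩ := h
  obtain ⟨P₀, _, ⟨e₀⟩⟩ := hright 0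
  obtain ⟨P₁, _, ⟨e₁⟩⟩ := hright 1
  obtain ⟨i, r, hri⟩ := exists_retract_finsupp e₀
  obtain ⟨i₁, r₁, hr₁⟩ := exists_retract_finsupp e₁
  let f : M →ₗ[R] X.right 0 := (LinearMap.range X.mid).subtype ∘ₗ e.toLinearMap
  have hf : Function.Exact f (X.dRight 0) := by
    rw [LinearMap.exact_iff, hexact.mid_right.linearMap_ker_eq, LinearMap.range_comp,
      LinearEquiv.range, Submodule.map_top, Submodule.range_subtype]
  let k : X.right 1 × (P₀ →₀ C) →ₗ[R] (P₁ ⊕ P₀ →₀ C) :=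
    (Finsupp.sumFinsuppLEquivProdFinsupp R).symm.toLinearMap ∘ₗ
      i₁.prodMap LinearMap.id
  have hk : Function.Injective k :=
    (Finsupp.sumFinsuppLEquivProdFinsupp R).symm.injective.comp <| Prod.map_injective.mpr
      ⟨LinearMap.injective_of_comp_eq_id _ _ hr₁, Function.injective_id⟩
  refine ⟨P₀, P₁ ⊕ P₀, i ∘ₗ f, k ∘ₗ (X.dRight 0 ∘ₗ r).prod (LinearMap.id - i ∘ₗ r),
    (LinearMap.injective_of_comp_eq_id _ _ hri).comp
      (Subtype.val_injective.comp e.injective),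
    hk.comp_exact_iff_exact.mpr (exact_comp_prod_of_retract hf hri), fun φ => ?_⟩
  have hC : Function.Exact (X.mid.lcomp R C) ((X.dLeft 0).lcomp R C) :=
    exact_lcomp_of_equiv (TensorProduct.rid R C)
      (hhom (ModuleCat.of R R) (inferInstanceAs (Module.Projective R R))).left_mid
  obtain ⟨ψ, hψ⟩ := (exact_lcomp_iff_exists_extend hexact.left_mid).mp hC (φ ∘ₗ e.symm.toLinearMap)
  refine ⟨ψ ∘ₗ r, ?_⟩
  calc (ψ ∘ₗ r) ∘ₗ i ∘ₗ f = ψ ∘ₗ (r ∘ₗ i) ∘ₗ f := rfl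
    _ = (ψ ∘ₗ (LinearMap.range X.mid).subtype) ∘ₗ e.toLinearMap := by rw [hri]; rfl
    _ = φ := by rw [hψ]; ext; simp

theorem IsGCProjective.exists_finite_copresentation [Module.Finite R C] [Module.Finite R M]
    (h : IsGCProjective R C M) :
    ∃ (s t : Type u) (_ : Finite s) (_ : Finite t) (j : M →ₗ[R] (s → C))
      (d : (s → C) →ₗ[R] (t → C)), Function.Injective j ∧ Function.Exact j d ∧
      ∀ φ : M →ₗ[R] C, ∃ ψ : (s → C) →ₗ[R] C, ψ ∘ₗ j = φ := by
  obtain ⟨S, T, j, d, hj, hjd, hext⟩ := h.exists_finsupp_copresentation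
  obtain ⟨s, a, b, hb, rfl⟩ := exists_factor_finsupp j
  obtain ⟨t, a', b', hb', hab'⟩ := exists_factor_finsupp (d ∘ₗ b)
  refine ⟨s, t, inferInstance, inferInstance, a, a', .of_comp (f := b) hj, ?_, fun φ => ?_⟩
  · rw [← hb'.comp_exact_iff_exact, hab']
    intro x
    rw [LinearMap.comp_apply, hjd (b x)]
    simp [hb.eq_iff]
  · obtain ⟨ψ, rfl⟩ := hext φ
    exact ⟨ψ ∘ₗ b, rfl⟩

end FiniteCopresentation

/-- The hypothesis of the theorem: finitely generated submodules of `G_C`-projective modules are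
`G_C`-projective. -/
def FGSubmodulesGCProjective (R : Type u) [CommRing R] (C : Type u) [AddCommGroup C]
    [Module R C] : Prop :=
  ∀ G : ModuleCat.{u} R, IsGCProjective R C G →
    ∀ N : Submodule R G, N.FG → IsGCProjective R C N

section Duality

theorem ShortExact.lcomp {R A B D W : Type*} [CommRing R] [AddCommGroup A] [Module R A]
    [AddCommGroup B] [Module R B] [AddCommGroup D] [Module R D] [AddCommGroup W] [Module R W]
    {f : A →ₗ[R] B} {g : B →ₗ[R] D} (h : ShortExact f g)
    (hext : ∀ φ : A →ₗ[R] W, ∃ ψ : B →ₗ[R] W, ψ ∘ₗ f = φ) :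
    ShortExact (g.lcomp R W) (f.lcomp R W) :=
  ⟨LinearMap.lcomp_injective_of_surjective g h.surjective,
    LinearMap.exact_lcomp_of_exact_of_surjective W h.exact h.surjective, hext⟩

variable {R : Type u} [CommRing R] {C : Type u} [AddCommGroup C] [Module R C]

theorem IsSemidualizing.finite (hC : IsSemidualizing R C) : Module.Finite R C := by
  obtain ⟨X, hX⟩ := hC.exists_resolution
  have := (hX 0).1
  exact Module.Finite.of_surjective X.ε X.surjective_ε

theorem IsSemidualizing.exists_injective_pi (hC : IsSemidualizing R C) :
    ∃ (t : Type u) (_ : Finite t) (f : R →ₗ[R] (t → C)), Function.Injective f := by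
  obtain ⟨t, ht⟩ := hC.finite.fg_top
  refine ⟨t, inferInstance, LinearMap.pi fun c => LinearMap.toSpanSingleton R C c, ?_⟩
  intro x y hxy
  exact hC.bijective_homothety.1 (LinearMap.ext_on ht fun c hc => congrFun hxy ⟨c, hc⟩)

/-- The isomorphism `R^s ≅ Hom(C^s, C)` induced by the homothety isomorphism `R ≅ Hom(C, C)`. -/
noncomputable def IsSemidualizing.piDualEquiv (hC : IsSemidualizing R C) (s : Type*) [Fintype s] :
    (s → R) ≃ₗ[R] ((s → C) →ₗ[R] C) := by
  classical
  exact (LinearEquiv.piCongrRight fun _ =>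
    LinearEquiv.ofBijective (LinearMap.lsmul R C) hC.bijective_homothety).trans
      (LinearMap.lsum R (fun _ : s => C) R)

theorem IsSemidualizing.piDualEquiv_eq_sum (hC : IsSemidualizing R C) {s : Type*} [Fintype s]
    (r : s → R) : hC.piDualEquiv s r = ∑ k, r k • LinearMap.proj k := by
  ext x
  simp [piDualEquiv]

variable {M : Type u} [AddCommGroup M] [Module R M]

theorem FGSubmodulesGCProjective.of_injective_pi (hsub : FGSubmodulesGCProjective R C)
    (hC : IsSemidualizing R C) [Module.Finite R M] {s : Type u} [Finite s] {i : M →ₗ[R] (s → C)}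
    (hi : Function.Injective i) : IsGCProjective R C M := by
  classical
  have := Fintype.ofFinite s
  let e := (TensorProduct.piScalarRight R R C s).symm
  let k : M →ₗ[R] C ⊗[R] (s → R) := e.toLinearMap ∘ₗ i
  have := hsub (ModuleCat.of R (C ⊗[R] (s → R)))
    (hC.isGCProjective_tensor (ModuleCat.of R (s → R))) (LinearMap.range k)
    (Module.Finite.iff_fg.mp (Module.Finite.range k))
  exact this.of_equiv (LinearEquiv.ofInjective k (e.injective.comp hi)).symm

theorem FGSubmodulesGCProjective.exists_shortExact (hsub : FGSubmodulesGCProjective R C)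
    (hC : IsSemidualizing R C) [Module.Finite R M] (hM : IsGCProjective R C M) :
    ∃ (s : Type u) (_ : Fintype s) (L : ModuleCat.{u} R) (j : M →ₗ[R] (s → C))
      (q : (s → C) →ₗ[R] L), Module.Finite R L ∧ IsGCProjective R C L ∧ ShortExact j q ∧
      ∀ φ : M →ₗ[R] C, ∃ ψ : (s → C) →ₗ[R] C, ψ ∘ₗ j = φ := by
  have := hC.finite
  obtain ⟨s, t, _, _, j, d, hj, hjd, hext⟩ := hM.exists_finite_copresentation
  exact ⟨s, Fintype.ofFinite s, ModuleCat.of R (LinearMap.range d), j, d.rangeRestrict,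
    Module.Finite.range d, hsub.of_injective_pi hC (LinearMap.range d).injective_subtype,
    .rangeRestrict hj hjd, hext⟩

theorem FGSubmodulesGCProjective.finite_dual (hsub : FGSubmodulesGCProjective R C)
    (hC : IsSemidualizing R C) [Module.Finite R M] (hM : IsGCProjective R C M) :
    Module.Finite R (M →ₗ[R] C) := by
  obtain ⟨s, _, L, j, q, -, -, -, hext⟩ := hsub.exists_shortExact hC hM
  have := Module.Finite.equiv (hC.piDualEquiv s)
  exact Module.Finite.of_surjective (j.lcomp R C) hext

theorem FGSubmodulesGCProjective.finitePresentation_dual (hsub : FGSubmodulesGCProjective R C)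
    (hC : IsSemidualizing R C) [Module.Finite R M] (hM : IsGCProjective R C M) :
    Module.FinitePresentation R (M →ₗ[R] C) := by
  obtain ⟨s, _, L, j, q, _, hL, h, hext⟩ := hsub.exists_shortExact hC hM
  have := Module.FinitePresentation.of_equiv (hC.piDualEquiv s)
  have := hsub.finite_dual hC hL
  have hdual := h.lcomp hext
  refine Module.finitePresentation_of_surjective (j.lcomp R C) hdual.surjective ?_
  rw [hdual.exact.linearMap_ker_eq]
  exact Module.Finite.iff_fg.mp (Module.Finite.range _)

theorem FGSubmodulesGCProjective.isGCProjective_dual (hsub : FGSubmodulesGCProjective R C)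
    (hC : IsSemidualizing R C) [hfinite : Module.Finite R M] (hM : IsGCProjective R C M) :
    IsGCProjective R C (M →ₗ[R] C) := by
  have := hsub.finite_dual hC hM
  obtain ⟨t, ht⟩ := hfinite.fg_top
  exact hsub.of_injective_pi hC (s := t) (i := LinearMap.pi fun m => LinearMap.applyₗ (m : M))
    fun φ ψ h => LinearMap.ext_on ht fun m hm => congrFun h ⟨m, hm⟩

theorem FGSubmodulesGCProjective.injective_applyₗ (hsub : FGSubmodulesGCProjective R C)
    (hC : IsSemidualizing R C) [Module.Finite R M] (hM : IsGCProjective R C M) :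
    Function.Injective (LinearMap.applyₗ : M →ₗ[R] (M →ₗ[R] C) →ₗ[R] C) := by
  obtain ⟨s, _, L, j, q, -, -, h, -⟩ := hsub.exists_shortExact hC hM
  intro m m' hmm'
  apply h.injective
  ext k
  exact LinearMap.congr_fun hmm' (LinearMap.proj k ∘ₗ j)

theorem FGSubmodulesGCProjective.bijective_applyₗ (hsub : FGSubmodulesGCProjective R C)
    (hC : IsSemidualizing R C) [Module.Finite R M] (hM : IsGCProjective R C M) :
    Function.Bijective (LinearMap.applyₗ : M →ₗ[R] (M →ₗ[R] C) →ₗ[R] C) := by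
  refine ⟨hsub.injective_applyₗ hC hM, fun Φ => ?_⟩
  obtain ⟨s, _, L, j, q, _, hL, h, hext⟩ := hsub.exists_shortExact hC hM
  -- `Φ ∘ j^*` is evaluation at a point `x` of `C^s`, which lies in `M` as it is killed by `L^*`
  let x : s → C := fun k => Φ (LinearMap.proj k ∘ₗ j)
  have hx (ψ : (s → C) →ₗ[R] C) : ψ x = Φ (ψ ∘ₗ j) := by
    obtain ⟨r, rfl⟩ := (hC.piDualEquiv s).surjective ψ
    have hj : (∑ k, r k • LinearMap.proj k) ∘ₗ j = ∑ k, r k • (LinearMap.proj k ∘ₗ j) := by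
      ext m
      simp
    rw [hC.piDualEquiv_eq_sum, hj, map_sum]
    simp [x]
  have hqx : q x = 0 := hsub.injective_applyₗ hC hL <| by
    ext θ
    calc θ (q x) = Φ (θ ∘ₗ q ∘ₗ j) := hx (θ ∘ₗ q)
      _ = LinearMap.applyₗ (0 : L) θ := by simp [h.exact.linearMap_comp_eq_zero]
  obtain ⟨m, hm⟩ := (h.exact x).mp hqx
  refine ⟨m, LinearMap.ext fun θ => ?_⟩
  obtain ⟨ψ, rfl⟩ := hext θ
  rw [← hx, ← hm]
  rfl

theorem FGSubmodulesGCProjective.finitePresentation (hsub : FGSubmodulesGCProjective R C)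
    (hC : IsSemidualizing R C) [Module.Finite R M] (hM : IsGCProjective R C M) :
    Module.FinitePresentation R M := by
  have := hsub.finite_dual hC hM
  have := hsub.finitePresentation_dual hC (hsub.isGCProjective_dual hC hM)
  exact .of_equiv (LinearEquiv.ofBijective _ (hsub.bijective_applyₗ hC hM)).symm

theorem FGSubmodulesGCProjective.isGCProjective_ideal (hsub : FGSubmodulesGCProjective R C)
    (hC : IsSemidualizing R C) {I : Ideal R} (hI : I.FG) : IsGCProjective R C I := by
  have : Module.Finite R I := Module.Finite.iff_fg.mpr hI
  obtain ⟨t, _, f, hf⟩ := hC.exists_injective_pi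
  exact hsub.of_injective_pi hC (i := f ∘ₗ I.subtype) (hf.comp Subtype.val_injective)

theorem FGSubmodulesGCProjective.isCoherent (hsub : FGSubmodulesGCProjective R C)
    (hC : IsSemidualizing R C) : IsCoherent R := by
  intro I hI
  have : Module.Finite R I := Module.Finite.iff_fg.mpr hI
  exact hsub.finitePresentation hC (hsub.isGCProjective_ideal hC hI)

end Duality

section HomEvaluation

/-- The evaluation map `M ⊗ Hom(A, B) → Hom(Hom(M, A), B)`, sending `m ⊗ g` to `h ↦ g (h m)`. -/
noncomputable def homEval (R M A B : Type*) [CommRing R] [AddCommGroup M] [Module R M]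
    [AddCommGroup A] [Module R A] [AddCommGroup B] [Module R B] :
    M ⊗[R] (A →ₗ[R] B) →ₗ[R] ((M →ₗ[R] A) →ₗ[R] B) :=
  TensorProduct.lift ((LinearMap.llcomp R (M →ₗ[R] A) A B).flip ∘ₗ LinearMap.applyₗ)

section

variable {R M N A B : Type*} [CommRing R] [AddCommGroup M] [Module R M] [AddCommGroup N]
  [Module R N] [AddCommGroup A] [Module R A] [AddCommGroup B] [Module R B]

@[simp]
theorem homEval_tmul (m : M) (g : A →ₗ[R] B) (h : M →ₗ[R] A) :
    homEval R M A B (m ⊗ₜ g) h = g (h m) := rfl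

theorem homEval_naturality (f : M →ₗ[R] N) :
    homEval R N A B ∘ₗ f.rTensor (A →ₗ[R] B) = (f.lcomp R A).lcomp R B ∘ₗ homEval R M A B := by
  ext m g h
  rfl

variable (R A B) in
theorem bijective_homEval_pi (ι : Type*) [Finite ι] :
    Function.Bijective (homEval R (ι → R) A B) := by
  classical
  have := Fintype.ofFinite ι
  let e : (ι → R) ⊗[R] (A →ₗ[R] B) ≃ₗ[R] (((ι → R) →ₗ[R] A) →ₗ[R] B) :=
    TensorProduct.comm R _ _ ≪≫ₗ TensorProduct.piScalarRight R R (A →ₗ[R] B) ι ≪≫ₗ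
      LinearMap.lsum R (fun _ : ι => A) R ≪≫ₗ ((Pi.basisFun R ι).constr R).congrLeft B R
  have he : homEval R (ι → R) A B = e.toLinearMap := by
    ext i g h
    simp [e, LinearEquiv.congrLeft, Pi.single_apply, DFunLike.ite_apply]
  rw [he]
  exact e.bijective

end

section

variable {R : Type u} [CommRing R] {M N A E : Type u} [AddCommGroup M] [Module R M]
  [AddCommGroup N] [Module R N] [AddCommGroup A] [Module R A] [AddCommGroup E] [Module R E]
  [Module.Injective R E]

theorem exists_extend_of_injective {f : M →ₗ[R] N} (hf : Function.Injective f)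
    (φ : M →ₗ[R] E) : ∃ ψ : N →ₗ[R] E, ψ ∘ₗ f = φ := by
  obtain ⟨ψ, hψ⟩ := Module.Injective.out f hf φ
  exact ⟨ψ, LinearMap.ext hψ⟩

variable [Module.FinitePresentation R M]

theorem bijective_homEval : Function.Bijective (homEval R M A E) := by
  obtain ⟨n, m, f, g, hf, hgf⟩ := Module.FinitePresentation.exists_fin' R M
  have hsurj : Function.Surjective ((f.lcomp R A).lcomp R E) :=
    exists_extend_of_injective (LinearMap.lcomp_injective_of_surjective f hf)
  have hexact : Function.Exact ((g.lcomp R A).lcomp R E) ((f.lcomp R A).lcomp R E) :=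
    (exact_lcomp_iff_exists_extend
      (LinearMap.exact_lcomp_of_exact_of_surjective A hgf hf)).mpr
      (exists_extend_of_injective (Submodule.injective_subtype _))
  exact LinearMap.bijective_of_surjective_of_bijective_of_right_exact _ _ _ _ _ _ _
    (homEval_naturality g).symm (homEval_naturality f).symm (rTensor_exact _ hgf hf) hexact
    (bijective_homEval_pi R A E (Fin m)).2 (bijective_homEval_pi R A E (Fin n))
    (LinearMap.rTensor_surjective _ hf) hsurj

theorem injective_lTensor_hom_of_exists_extend {f : M →ₗ[R] N}
    (h : ∀ φ : M →ₗ[R] A, ∃ ψ : N →ₗ[R] A, ψ ∘ₗ f = φ) :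
    Function.Injective (f.lTensor (A →ₗ[R] E)) := by
  have hcomp : Function.Injective (homEval R N A E ∘ₗ f.rTensor (A →ₗ[R] E)) := by
    rw [homEval_naturality]
    exact (LinearMap.lcomp_injective_of_surjective (f.lcomp R A) h).comp bijective_homEval.1
  exact (LinearMap.lTensor_inj_iff_rTensor_inj _ f).mpr (.of_comp hcomp)

end

end HomEvaluation

section TorVanishing

theorem injective_rTensor_of_injective_lTensor {R T₁ T₀ J A B D : Type*} [CommRing R]
    [AddCommGroup T₁] [Module R T₁] [AddCommGroup T₀] [Module R T₀] [AddCommGroup J] [Module R J]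
    [AddCommGroup A] [Module R A] [AddCommGroup B] [Module R B] [AddCommGroup D] [Module R D]
    {t : T₁ →ₗ[R] T₀} {p : T₀ →ₗ[R] J} (htp : Function.Exact t p) (hp : Function.Surjective p)
    {f : A →ₗ[R] B} {g : B →ₗ[R] D} (hfg : Function.Exact f g) (hg : Function.Surjective g)
    (ht : Function.Injective (t.rTensor B)) (hf : Function.Injective (f.lTensor J)) :
    Function.Injective (t.rTensor D) := by
  rw [injective_iff_map_eq_zero]
  intro x hx
  obtain ⟨y, rfl⟩ := LinearMap.lTensor_surjective T₁ hg x
  obtain ⟨z, hz⟩ := (lTensor_exact T₀ hfg hg (t.rTensor B y)).mp (by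
    rwa [← LinearMap.comp_apply, LinearMap.lTensor_comp_rTensor,
      ← LinearMap.rTensor_comp_lTensor])
  have hpz : p.rTensor A z = 0 := hf <| by
    rw [map_zero, ← LinearMap.comp_apply, LinearMap.lTensor_comp_rTensor,
      ← LinearMap.rTensor_comp_lTensor, LinearMap.comp_apply, hz]
    exact (rTensor_exact B htp hp).apply_apply_eq_zero y
  obtain ⟨v, rfl⟩ := (rTensor_exact A htp hp z).mp hpz
  have hv : f.lTensor T₁ v = y := ht <| by
    rw [← hz, ← LinearMap.comp_apply, ← LinearMap.comp_apply, LinearMap.rTensor_comp_lTensor,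
      LinearMap.lTensor_comp_rTensor]
  rw [← hv]
  exact (lTensor_exact T₁ hfg hg).apply_apply_eq_zero v

variable {R : Type u} [CommRing R]

/-- The vanishing of `Tor₁(J, D)`, phrased without derived functors: `J ⊗ -` preserves the
injectivity of the first map of every short exact sequence ending in `D`. -/
def TorVanishes (R : Type u) [CommRing R] (J D : Type u) [AddCommGroup J] [Module R J]
    [AddCommGroup D] [Module R D] : Prop :=
  ∀ ⦃A B : Type u⦄ [AddCommGroup A] [Module R A] [AddCommGroup B] [Module R B]
    ⦃f : A →ₗ[R] B⦄ ⦃g : B →ₗ[R] D⦄, ShortExact f g → Function.Injective (f.lTensor J)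

variable {J D : Type u} [AddCommGroup J] [Module R J] [AddCommGroup D] [Module R D]

theorem TorVanishes.of_flat_cover {K F : Type u} [AddCommGroup K] [Module R K] [AddCommGroup F]
    [Module R F] [Module.Flat R F] {k : K →ₗ[R] F} {q : F →ₗ[R] D} (hkq : Function.Exact k q)
    (hq : Function.Surjective q) (hk : Function.Injective (k.lTensor J)) :
    TorVanishes R D J := by
  intro A B _ _ _ _ f g h
  rw [LinearMap.lTensor_inj_iff_rTensor_inj]
  exact injective_rTensor_of_injective_lTensor h.exact h.surjective hkq hq
    (Module.Flat.rTensor_preserves_injective_linearMap f h.injective) hk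

variable (R J) in
theorem exists_shortExact_projective : ∃ (K F : ModuleCat.{u} R) (k : K →ₗ[R] F) (p : F →ₗ[R] J),
    Module.Projective R F ∧ ShortExact k p := by
  let F := ModuleCat.of R (J →₀ R)
  let p : F →ₗ[R] J := Finsupp.linearCombination R id
  exact ⟨ModuleCat.of R (LinearMap.ker p), F, (LinearMap.ker p).subtype, p,
    inferInstanceAs (Module.Projective R (J →₀ R)),
    .ker_subtype (Finsupp.linearCombination_id_surjective R J)⟩

theorem TorVanishes.symm (h : TorVanishes R J D) : TorVanishes R D J := by
  obtain ⟨K, F, k, p, _, hkp⟩ := exists_shortExact_projective R D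
  exact .of_flat_cover hkp.exact hkp.surjective (h hkp)

theorem TorVanishes.of_flat_left [Module.Flat R J] : TorVanishes R J D :=
  fun _ _ _ _ _ _ _ _ h => Module.Flat.lTensor_preserves_injective_linearMap _ h.injective

theorem TorVanishes.flat_tensor (h : TorVanishes R J D) (F : Type u) [AddCommGroup F] [Module R F]
    [Module.Flat R F] : TorVanishes R (F ⊗[R] J) D := by
  intro A B _ _ _ _ f g hfg
  rw [LinearMap.lTensor_tensor]
  exact (TensorProduct.assoc R F J B).symm.injective.comp
    ((Module.Flat.lTensor_preserves_injective_linearMap _ (h hfg)).comp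
      (TensorProduct.assoc R F J A).injective)

variable {T₁ T₀ : Type u} [AddCommGroup T₁] [Module R T₁] [AddCommGroup T₀] [Module R T₀]
  {t : T₁ →ₗ[R] T₀} {p : T₀ →ₗ[R] J}

theorem ShortExact.flat_of_torVanishes [Module.Flat R T₀] (h : ShortExact t p)
    (hJ : ∀ I : Ideal R, I.FG → TorVanishes R J I) : Module.Flat R T₁ := by
  rw [Module.Flat.iff_lTensor_injective]
  intro I hI
  have hcomp : Function.Injective (I.subtype.lTensor T₀ ∘ₗ t.rTensor I) :=
    (Module.Flat.lTensor_preserves_injective_linearMap _ Subtype.val_injective).comp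
      ((LinearMap.lTensor_inj_iff_rTensor_inj _ t).mp ((hJ I hI).symm h))
  rw [LinearMap.lTensor_comp_rTensor, ← LinearMap.rTensor_comp_lTensor] at hcomp
  exact .of_comp hcomp

theorem TorVanishes.of_injective {N : Type u} [AddCommGroup N] [Module R N] {i : N →ₗ[R] D}
    (hi : Function.Injective i) (hD : TorVanishes R J D)
    (hJ : ∀ I : Ideal R, I.FG → TorVanishes R J I) : TorVanishes R J N := by
  obtain ⟨K, F, k, p, _, h⟩ := exists_shortExact_projective R J
  have := h.flat_of_torVanishes hJ
  refine .of_flat_cover h.exact h.surjective ?_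
  have hcomp : Function.Injective (k.rTensor D ∘ₗ i.lTensor K) :=
    ((LinearMap.lTensor_inj_iff_rTensor_inj _ k).mp (hD.symm h)).comp
      (Module.Flat.lTensor_preserves_injective_linearMap i hi)
  rw [LinearMap.rTensor_comp_lTensor, ← LinearMap.lTensor_comp_rTensor] at hcomp
  exact (LinearMap.lTensor_inj_iff_rTensor_inj _ k).mpr (.of_comp hcomp)

end TorVanishing

section HomTorVanishing

variable {R : Type u} [CommRing R] {C : Type u} [AddCommGroup C] [Module R C]

/-- The vanishing of `Tor₁(Hom(C, E), D)` for every injective module `E`. -/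
def HomTorVanishes (R : Type u) [CommRing R] (C : Type u) [AddCommGroup C] [Module R C]
    (D : Type u) [AddCommGroup D] [Module R D] : Prop :=
  ∀ E : ModuleCat.{u} R, Module.Injective R E → TorVanishes R (C →ₗ[R] E) D

variable {M : Type u} [AddCommGroup M] [Module R M]

theorem FGSubmodulesGCProjective.homTorVanishes (hsub : FGSubmodulesGCProjective R C)
    (hC : IsSemidualizing R C) [Module.Finite R M] (hM : IsGCProjective R C M) :
    HomTorVanishes R C M := by
  intro E _
  have := hsub.finite_dual hC hM
  obtain ⟨s, _, L, j, q, _, hL, h, hext⟩ :=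
    hsub.exists_shortExact hC (hsub.isGCProjective_dual hC hM)
  have := hsub.finitePresentation_dual hC hL
  have := Module.Flat.of_linearEquiv (hC.piDualEquiv s).symm
  have hdual := h.lcomp hext
  have hextdual (φ : (L →ₗ[R] C) →ₗ[R] C) :
      ∃ ψ : ((s → C) →ₗ[R] C) →ₗ[R] C, ψ ∘ₗ q.lcomp R C = φ := by
    obtain ⟨l, rfl⟩ := (hsub.bijective_applyₗ hC hL).2 φ
    obtain ⟨x, rfl⟩ := h.surjective l
    exact ⟨LinearMap.applyₗ x, rfl⟩
  let e := LinearEquiv.ofBijective _ (hsub.bijective_applyₗ hC hM)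
  exact (TorVanishes.of_flat_cover (q := e.symm.toLinearMap ∘ₗ j.lcomp R C)
    (e.symm.injective.comp_exact_iff_exact.mpr hdual.exact)
    (e.symm.surjective.comp hdual.surjective)
    (injective_lTensor_hom_of_exists_extend hextdual)).symm

theorem FGSubmodulesGCProjective.homTorVanishes_ideal (hsub : FGSubmodulesGCProjective R C)
    (hC : IsSemidualizing R C) {I : Ideal R} (hI : I.FG) : HomTorVanishes R C I := by
  have : Module.Finite R I := Module.Finite.iff_fg.mpr hI
  exact hsub.homTorVanishes hC (hsub.isGCProjective_ideal hC hI)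

theorem FGSubmodulesGCProjective.homTorVanishes_self (hsub : FGSubmodulesGCProjective R C)
    (hC : IsSemidualizing R C) : HomTorVanishes R C C := by
  have := hC.finite
  exact hsub.homTorVanishes hC
    ((hC.isGCProjective_tensor (ModuleCat.of R R)).of_equiv (TensorProduct.rid R C))

end HomTorVanishing

section Coresolution

theorem exists_exact_of_exact {R N A Z M B G : Type*} [CommRing R] [AddCommGroup N] [Module R N]
    [AddCommGroup A] [Module R A] [AddCommGroup Z] [Module R Z] [AddCommGroup M] [Module R M]
    [AddCommGroup B] [Module R B] [AddCommGroup G] [Module R G]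
    {i : N →ₗ[R] A} (hi : Function.Injective i) {l : A →ₗ[R] M} (hl : Function.Injective l)
    {s : M →ₗ[R] B} (hls : Function.Exact l s) {γ : G →ₗ[R] M} (hγ : Function.Injective γ)
    {c : M →ₗ[R] Z} (hγc : Function.Exact γ c) (hic : Function.Exact i (c ∘ₗ l)) :
    ∃ n : N →ₗ[R] G, Function.Injective n ∧ Function.Exact n (s ∘ₗ γ) := by
  have hli (x : N) : (l ∘ₗ i) x ∈ LinearMap.range γ := (hγc _).mp (hic.apply_apply_eq_zero x)
  let n : N →ₗ[R] G := LinearMap.codRestrictOfInjective (l ∘ₗ i) γ hγ hli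
  have hn (x : N) : γ (n x) = l (i x) := LinearMap.codRestrictOfInjective_comp_apply ..
  refine ⟨n, .of_comp (f := γ) ?_, fun y => ⟨fun hy => ?_, ?_⟩⟩
  · simpa only [Function.comp_def, hn] using hl.comp hi
  · obtain ⟨a, ha⟩ := (hls (γ y)).mp hy
    obtain ⟨x, rfl⟩ := (hic a).mp (by
      rw [LinearMap.comp_apply, ha, hγc.apply_apply_eq_zero])
    exact ⟨x, hγ (by rw [hn, ha])⟩
  · rintro ⟨x, rfl⟩
    rw [LinearMap.comp_apply, hn, hls.apply_apply_eq_zero]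

theorem flat_prod (R A B : Type*) [CommRing R] [AddCommGroup A] [Module R A] [AddCommGroup B]
    [Module R B] [Module.Flat R A] [Module.Flat R B] : Module.Flat R (A × B) := by
  rw [Module.Flat.iff_lTensor_injective]
  intro I _
  have hcomp : TensorProduct.prodLeft R R A B R ∘ₗ I.subtype.lTensor (A × B) =
      (I.subtype.lTensor A).prodMap (I.subtype.lTensor B) ∘ₗ TensorProduct.prodLeft R R A B I :=
    TensorProduct.ext' fun _ _ => rfl
  refine .of_comp (f := TensorProduct.prodLeft R R A B R) ?_
  rw [← LinearEquiv.coe_toLinearMap, ← LinearMap.coe_comp, hcomp, LinearMap.coe_comp]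
  exact (Prod.map_injective.mpr
    ⟨Module.Flat.lTensor_preserves_injective_linearMap _ Subtype.val_injective,
      Module.Flat.lTensor_preserves_injective_linearMap _ Subtype.val_injective⟩).comp
    (LinearEquiv.injective _)

variable {R : Type u} [CommRing R] {C : Type u} [AddCommGroup C] [Module R C]

theorem exists_injective_to_injective (M : Type u) [AddCommGroup M] [Module R M] :
    ∃ (E : ModuleCat.{u} R) (i : M →ₗ[R] E), Module.Injective R E ∧ Function.Injective i :=
  let E := CategoryTheory.Injective.under (ModuleCat.of R M)
  ⟨E, (CategoryTheory.Injective.ι (ModuleCat.of R M)).hom,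
    Module.injective_module_of_injective_object R E
      (inj := inferInstanceAs (CategoryTheory.Injective E)),
    (ModuleCat.mono_iff_injective _).mp inferInstance⟩

theorem IsSemidualizing.finitePresentation (hC : IsSemidualizing R C) :
    Module.FinitePresentation R C := by
  obtain ⟨X, hX⟩ := hC.exists_resolution
  have := (hX 0).1
  have := (hX 0).2
  have := (hX 1).1
  have := Module.finitePresentation_of_projective R (X.obj 0)
  refine Module.finitePresentation_of_surjective X.ε X.surjective_ε ?_
  rw [X.exact_ε.linearMap_ker_eq]
  exact Module.Finite.iff_fg.mp (Module.Finite.range _)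

theorem IsSemidualizing.bijective_lift_applyₗ (hC : IsSemidualizing R C) (E : Type u)
    [AddCommGroup E] [Module R E] [Module.Injective R E] : Function.Bijective
      (TensorProduct.lift (LinearMap.applyₗ : C →ₗ[R] (C →ₗ[R] E) →ₗ[R] E)) := by
  have := hC.finitePresentation
  let e : ((C →ₗ[R] C) →ₗ[R] E) ≃ₗ[R] E :=
    (LinearEquiv.ofBijective _ hC.bijective_homothety).symm.congrLeft E R ≪≫ₗ
      LinearMap.ringLmapEquivSelf R R E
  have he : TensorProduct.lift LinearMap.applyₗ = e.toLinearMap ∘ₗ homEval R C C E := by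
    ext c g
    simp [e, LinearEquiv.congrLeft]
  rw [he]
  exact e.bijective.comp bijective_homEval

theorem exists_exact_tensor_flat (hC : IsSemidualizing R C) (hself : HomTorVanishes R C C)
    (hideal : ∀ I : Ideal R, I.FG → HomTorVanishes R C I) {N F : Type u} [AddCommGroup N]
    [Module R N] [AddCommGroup F] [Module R F] [Module.Flat R F] {i : N →ₗ[R] C ⊗[R] F}
    (hi : Function.Injective i) :
    ∃ (G G₀ : ModuleCat.{u} R) (_ : Module.Flat R G) (_ : Module.Flat R G₀)
      (n : N →ₗ[R] C ⊗[R] G) (d : C ⊗[R] G →ₗ[R] C ⊗[R] G₀),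
      Function.Injective n ∧ Function.Exact n d := by
  obtain ⟨E, ι, _, hι⟩ := exists_injective_to_injective (R := R) (C ⊗[R] F ⧸ LinearMap.range i)
  let φ : C ⊗[R] F →ₗ[R] E := ι ∘ₗ (LinearMap.range i).mkQ
  have hiφ : Function.Exact i φ := hι.comp_exact_iff_exact.mpr (LinearMap.exact_map_mkQ_range i)
  let φ' : F →ₗ[R] C →ₗ[R] E := (TensorProduct.curry φ).flip
  have hφ' : TensorProduct.lift LinearMap.applyₗ ∘ₗ φ'.lTensor C = φ := by
    ext c x
    rfl
  obtain ⟨K, G₀, k, p, _, hkp⟩ := exists_shortExact_projective R (C →ₗ[R] E)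
  let π : F × G₀ →ₗ[R] C →ₗ[R] E := φ'.coprod p
  have hπ := ShortExact.ker_subtype (g := π) fun h =>
    (hkp.surjective h).imp' (fun y => (0, y)) (by simp [π])
  have := flat_prod R F G₀
  obtain ⟨n, hn, hnd⟩ := exists_exact_of_exact hi
    (l := (LinearMap.inl R F G₀).lTensor C) (s := (LinearMap.snd R F G₀).lTensor C)
    (γ := (LinearMap.ker π).subtype.lTensor C) (c := π.lTensor C)
    (LinearMap.injective_of_comp_eq_id _ ((LinearMap.fst R F G₀).lTensor C) (by
      rw [← LinearMap.lTensor_comp, LinearMap.fst_comp_inl, LinearMap.lTensor_id]))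
    (lTensor_exact C .inl_snd LinearMap.snd_surjective)
    ((hself E ‹_›).symm hπ) (lTensor_exact C hπ.exact hπ.surjective)
    ((hC.bijective_lift_applyₗ E).1.comp_exact_iff_exact.mp (by
      rw [← LinearMap.lTensor_comp, LinearMap.coprod_inl]
      exact hφ' ▸ hiφ))
  exact ⟨ModuleCat.of R (LinearMap.ker π), G₀,
    hπ.flat_of_torVanishes fun I hI => hideal I hI E ‹_›, inferInstance, n, _, hn, hnd⟩

variable (R C) in
/-- The modules isomorphic to a submodule of some `C ⊗ F` with `F` flat. -/
def EmbedsInTensorFlat (N : Type u) [AddCommGroup N] [Module R N] : Prop :=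
  ∃ (F : ModuleCat.{u} R) (i : N →ₗ[R] C ⊗[R] F), Module.Flat R F ∧ Function.Injective i

variable {N : Type u} [AddCommGroup N] [Module R N]

theorem EmbedsInTensorFlat.homTorVanishes (hN : EmbedsInTensorFlat R C N)
    (hself : HomTorVanishes R C C) (hideal : ∀ I : Ideal R, I.FG → HomTorVanishes R C I) :
    HomTorVanishes R C N := by
  obtain ⟨F, i, _, hi⟩ := hN
  intro E hE
  exact .of_injective (i := (TensorProduct.comm R C F).toLinearMap ∘ₗ i)
    ((TensorProduct.comm R C F).injective.comp hi) ((hself E hE).symm.flat_tensor F).symm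
    fun I hI => hideal I hI E hE

theorem EmbedsInTensorFlat.exists_shortExact (hN : EmbedsInTensorFlat R C N)
    (hC : IsSemidualizing R C) (hself : HomTorVanishes R C C)
    (hideal : ∀ I : Ideal R, I.FG → HomTorVanishes R C I) :
    ∃ (G N' : ModuleCat.{u} R) (j : N →ₗ[R] C ⊗[R] G) (q : C ⊗[R] G →ₗ[R] N'),
      Module.Flat R G ∧ EmbedsInTensorFlat R C N' ∧ ShortExact j q := by
  obtain ⟨F, i, _, hi⟩ := hN
  obtain ⟨G, G₀, hG, hG₀, n, d, hn, hnd⟩ := exists_exact_tensor_flat hC hself hideal hi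
  exact ⟨G, ModuleCat.of R (LinearMap.range d), n, d.rangeRestrict, hG,
    ⟨G₀, (LinearMap.range d).subtype, hG₀, Subtype.val_injective⟩, .rangeRestrict hn hnd⟩

theorem HomTorVanishes.of_injective_of_flat
    (hideal : ∀ I : Ideal R, I.FG → HomTorVanishes R C I) {F : Type u} [AddCommGroup F]
    [Module R F] [Module.Flat R F] {i : N →ₗ[R] F} (hi : Function.Injective i) :
    HomTorVanishes R C N :=
  fun E hE => .of_injective hi TorVanishes.of_flat_left.symm fun I hI => hideal I hI E hE

theorem IsSemidualizing.embedsInTensorFlat (hC : IsSemidualizing R C) {F : Type u}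
    [AddCommGroup F] [Module R F] [Module.Flat R F] {i : N →ₗ[R] F} (hi : Function.Injective i) :
    EmbedsInTensorFlat R C N := by
  obtain ⟨t, _, f, hf⟩ := hC.exists_injective_pi
  have := Fintype.ofFinite t
  classical
  let e : (t → C) ⊗[R] F ≃ₗ[R] C ⊗[R] ((t → R) ⊗[R] F) :=
    (TensorProduct.piScalarRight R R C t).symm.rTensor F ≪≫ₗ TensorProduct.assoc R C (t → R) F
  exact ⟨ModuleCat.of R ((t → R) ⊗[R] F),
    e.toLinearMap ∘ₗ f.rTensor F ∘ₗ (TensorProduct.lid R F).symm.toLinearMap ∘ₗ i,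
    inferInstanceAs (Module.Flat R ((t → R) ⊗[R] F)),
    e.injective.comp ((Module.Flat.rTensor_preserves_injective_linearMap f hf).comp
      ((TensorProduct.lid R F).symm.injective.comp hi))⟩

end Coresolution

section Splice

theorem exact_comp_comp {R Z A B D W : Type*} [Ring R] [AddCommGroup Z] [Module R Z]
    [AddCommGroup A] [Module R A] [AddCommGroup B] [Module R B] [AddCommGroup D] [Module R D]
    [AddCommGroup W] [Module R W] {p : Z →ₗ[R] A} {f : A →ₗ[R] B} {g : B →ₗ[R] D} {j : D →ₗ[R] W}
    (hp : Function.Surjective p) (h : Function.Exact f g) (hj : Function.Injective j) :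
    Function.Exact (f ∘ₗ p) (j ∘ₗ g) :=
  hp.comp_exact_iff_exact.mpr (hj.comp_exact_iff_exact.mpr h)

theorem exact_lTensor_comp_comp {R Z A B D W : Type*} [CommRing R] [AddCommGroup Z] [Module R Z]
    [AddCommGroup A] [Module R A] [AddCommGroup B] [Module R B] [AddCommGroup D] [Module R D]
    [AddCommGroup W] [Module R W] (J : Type*) [AddCommGroup J] [Module R J] {p : Z →ₗ[R] A}
    {f : A →ₗ[R] B} {g : B →ₗ[R] D} {j : D →ₗ[R] W} (hp : Function.Surjective p)
    (h : Function.Exact f g) (hg : Function.Surjective g) (hj : Function.Injective (j.lTensor J)) :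
    Function.Exact ((f ∘ₗ p).lTensor J) ((j ∘ₗ g).lTensor J) := by
  rw [LinearMap.lTensor_comp, LinearMap.lTensor_comp]
  exact exact_comp_comp (LinearMap.lTensor_surjective J hp) (lTensor_exact J h hg) hj

variable {R : Type u} [CommRing R]

variable {A F B G : ℕ → ModuleCat.{u} R} {k : ∀ n, A (n + 1) →ₗ[R] F n}
  {p : ∀ n, F n →ₗ[R] A n} {j : ∀ n, B n →ₗ[R] G n} {q : ∀ n, G n →ₗ[R] B (n + 1)}

/-- The sequence `⋯ → F 1 → F 0 → G 0 → G 1 → ⋯` whose maps factor through the syzygies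
`A (n + 1)`, the module `A 0 ≃ B 0` and the cosyzygies `B (n + 1)`. -/
def TwoSidedSeq.splice (k : ∀ n, A (n + 1) →ₗ[R] F n) (p : ∀ n, F n →ₗ[R] A n)
    (e : A 0 ≃ₗ[R] B 0) (j : ∀ n, B n →ₗ[R] G n) (q : ∀ n, G n →ₗ[R] B (n + 1)) :
    TwoSidedSeq R where
  left := F
  right := G
  dLeft n := k n ∘ₗ p (n + 1)
  mid := j 0 ∘ₗ e.toLinearMap ∘ₗ p 0
  dRight n := j (n + 1) ∘ₗ q n

theorem TwoSidedSeq.isExact_splice (hkp : ∀ n, ShortExact (k n) (p n)) (e : A 0 ≃ₗ[R] B 0)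
    (hjq : ∀ n, ShortExact (j n) (q n)) : (splice k p e j q).IsExact where
  left n := exact_comp_comp (hkp _).surjective (hkp (n + 1)).exact (hkp n).injective
  left_mid := exact_comp_comp (j := j 0 ∘ₗ e.toLinearMap) (hkp 1).surjective (hkp 0).exact
    ((hjq 0).injective.comp e.injective)
  mid_right := exact_comp_comp (p := e.toLinearMap ∘ₗ p 0) (e.surjective.comp (hkp 0).surjective)
    (hjq 0).exact (hjq 1).injective
  right n := exact_comp_comp (hjq n).surjective (hjq (n + 1)).exact (hjq _).injective

theorem TwoSidedSeq.isTensorExact_splice {J : Type u} [AddCommGroup J] [Module R J]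
    (hkp : ∀ n, ShortExact (k n) (p n)) (hA : ∀ n, TorVanishes R J (A n)) (e : A 0 ≃ₗ[R] B 0)
    (hjq : ∀ n, ShortExact (j n) (q n)) (hB : ∀ n, TorVanishes R J (B (n + 1))) :
    (splice k p e j q).IsTensorExact J where
  left n := exact_lTensor_comp_comp J (hkp _).surjective (hkp (n + 1)).exact (hkp _).surjective
    (hA n (hkp n))
  left_mid := exact_lTensor_comp_comp (j := j 0 ∘ₗ e.toLinearMap) J (hkp 1).surjective
    (hkp 0).exact (hkp 0).surjective (by
      rw [LinearMap.lTensor_comp]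
      exact (hB 0 (hjq 0)).comp (e.lTensor J).injective)
  mid_right := exact_lTensor_comp_comp (p := e.toLinearMap ∘ₗ p 0) J
    (e.surjective.comp (hkp 0).surjective) (hjq 0).exact (hjq 0).surjective (hB 1 (hjq 1))
  right n := exact_lTensor_comp_comp J (hjq n).surjective (hjq (n + 1)).exact (hjq _).surjective
    (hB _ (hjq _))

end Splice

section GCFlat

variable {R : Type u} [CommRing R] {C : Type u} [AddCommGroup C] [Module R C]

theorem exists_resolution_homTorVanishes (hideal : ∀ I : Ideal R, I.FG → HomTorVanishes R C I)
    (A₀ : ModuleCat.{u} R) (hA₀ : HomTorVanishes R C A₀) :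
    ∃ (A F : ℕ → ModuleCat.{u} R) (k : ∀ n, A (n + 1) →ₗ[R] F n) (p : ∀ n, F n →ₗ[R] A n),
      Nonempty (A 0 ≃ₗ[R] A₀) ∧ (∀ n, Module.Flat R (F n)) ∧ (∀ n, HomTorVanishes R C (A n)) ∧
        ∀ n, ShortExact (k n) (p n) := by
  choose K F k p hF hkp using fun J : ModuleCat.{u} R => exists_shortExact_projective R J
  have hF' (J) : Module.Flat R (F J) := have := hF J; inferInstance
  have hK (J) : HomTorVanishes R C (K J) := .of_injective_of_flat hideal (hkp J).injective
  let A (n : ℕ) : ModuleCat.{u} R := n.rec A₀ fun _ => K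
  refine ⟨A, fun n => F (A n), fun n => k (A n), fun n => p (A n), ⟨.refl R A₀⟩,
    fun n => hF' (A n), fun n => ?_, fun n => hkp (A n)⟩
  cases n with
  | zero => exact hA₀
  | succ n => exact hK (A n)

theorem EmbedsInTensorFlat.exists_coresolution (hC : IsSemidualizing R C)
    (hself : HomTorVanishes R C C) (hideal : ∀ I : Ideal R, I.FG → HomTorVanishes R C I)
    (B₀ : ModuleCat.{u} R) (hB₀ : EmbedsInTensorFlat R C B₀) :
    ∃ (B G : ℕ → ModuleCat.{u} R) (j : ∀ n, B n →ₗ[R] C ⊗[R] G n)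
      (q : ∀ n, C ⊗[R] G n →ₗ[R] B (n + 1)),
      Nonempty (B₀ ≃ₗ[R] B 0) ∧ (∀ n, Module.Flat R (G n)) ∧
        (∀ n, EmbedsInTensorFlat R C (B n)) ∧ ∀ n, ShortExact (j n) (q n) := by
  choose G N' j q hG hN' hjq using
    fun N : {N : ModuleCat.{u} R // EmbedsInTensorFlat R C N} =>
      N.2.exists_shortExact hC hself hideal
  let B (n : ℕ) : {N : ModuleCat.{u} R // EmbedsInTensorFlat R C N} :=
    n.rec ⟨B₀, hB₀⟩ fun _ N => ⟨N' N, hN' N⟩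
  exact ⟨fun n => (B n).1, fun n => G (B n), fun n => j (B n), fun n => q (B n), ⟨.refl R B₀⟩,
    fun n => hG (B n), fun n => (B n).2, fun n => hjq (B n)⟩

theorem EmbedsInTensorFlat.isGCFlat {N : Type u} [AddCommGroup N] [Module R N]
    (hC : IsSemidualizing R C) (hself : HomTorVanishes R C C)
    (hideal : ∀ I : Ideal R, I.FG → HomTorVanishes R C I) (hN : EmbedsInTensorFlat R C N) :
    IsGCFlat R C N := by
  obtain ⟨A, F, k, p, ⟨eA⟩, hF, hA, hkp⟩ :=
    exists_resolution_homTorVanishes hideal (ModuleCat.of R N) (hN.homTorVanishes hself hideal)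
  obtain ⟨B, G, j, q, ⟨eB⟩, hG, hB, hjq⟩ :=
    exists_coresolution hC hself hideal (ModuleCat.of R N) hN
  let e := eA ≪≫ₗ eB
  refine ⟨.splice (G := fun n => ModuleCat.of R (C ⊗[R] G n)) k p e j q, hF,
    fun n => ⟨G n, hG n, ⟨.refl R _⟩⟩, TwoSidedSeq.isExact_splice hkp e hjq, ⟨?_⟩, fun E hE =>
      TwoSidedSeq.isTensorExact_splice hkp (fun n => hA n E hE) e hjq
        fun n => (hB (n + 1)).homTorVanishes hself hideal E hE⟩
  have hrange : LinearMap.range (j 0 ∘ₗ e.toLinearMap ∘ₗ p 0) = LinearMap.range (j 0) :=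
    LinearMap.range_comp_of_range_eq_top _
      (LinearMap.range_eq_top.mpr (e.surjective.comp (hkp 0).surjective))
  exact eB ≪≫ₗ .ofInjective (j 0) (hjq 0).injective ≪≫ₗ .ofEq _ _ hrange.symm

end GCFlat

end GCModules

theorem theorem3p10_general (R : Type u) [CommRing R] (C : Type u) [AddCommGroup C] [Module R C]
    (hC : GCModules.IsSemidualizing R C)
    (hsub : ∀ G : ModuleCat.{u} R, GCModules.IsGCProjective R C G →
      ∀ N : Submodule R G, N.FG → GCModules.IsGCProjective R C N) :
    GCModules.IsGCSemihereditary R C := by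
  have hsub : GCModules.FGSubmodulesGCProjective R C := hsub
  refine ⟨hsub.isCoherent hC, fun F _ N => ?_⟩
  have hN : GCModules.EmbedsInTensorFlat R C N := hC.embedsInTensorFlat N.injective_subtype
  exact hN.isGCFlat hC (hsub.homTorVanishes_self hC) fun _ => hsub.homTorVanishes_ideal hC

theorem theorem3p10 (R : Type u) [CommRing R] (C : Type u) [AddCommGroup C] [Module R C]
    (hC : GCModules.IsSemidualizing R C)
    (hfin : GCModules.gcWeakGlobalDim R C < ⊤)
    (hsub : ∀ G : ModuleCat.{u} R, GCModules.IsGCProjective R C G →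
      ∀ N : Submodule R G, N.FG → GCModules.IsGCProjective R C N) :
    GCModules.IsGCSemihereditary R C :=
  theorem3p10_general R C hC hsub
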